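/- Let $K, K'$ be finite geometric simplicial complexes in $\mathbb{R}^m$, let $k \ge 0$, and fix a field of coefficients. For $\omega \in \mathbb{S}^{m-1}$ let $h_\omega(x) = \langle x, \omega\rangle$, and let $\mathrm{Dgm}(h^K_\omega)$ denote the degree-$k$ persistence diagram of the lower-star filtration of $K$, whose complex at height $a$ consists of the simplices $\sigma \in K$ with $\max_{v \in \sigma} h_\omega(v) \le a$. It is a finite multiset of points $(b,d)$ with $b < d \le \infty$; the points with $d = \infty$ are the essential classes. Let $d_B(X,Y)$ be the bottleneck distance: the infimum over all partial matchings of $X$ and $Y$ of the maximum of the $L_\infty$-distances of matched points and of the values $\tfrac12|d-b|$ of unmatched points $(b,d)$, where $|\infty-\infty| = 0$ and $|\infty - d| = \infty$ for $d$ finite. Put $$H(\omega) = d_B\bigl(\mathrm{Dgm}(h^K_\omega), \mathrm{Dgm}(h^{K'}_\omega)\bigr), \qquad R_K = \max_{v \in K^{(0)}} \|v\|, \qquad R_{K'} = \max_{v \in (K')^{(0)}} \|v\|$$ (with the maximum read as $0$ for an empty complex). 1. If the diagrams are taken to consist of their points of finite persistence only, then $H$ is a real-valued function on $\mathbb{S}^{m-1}$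 and is Lipschitz continuous with constant $R_K + R_{K'}$ with respect to the Euclidean distance $\|\omega-\omega'\|$; in particular it is continuous. 2. If the diagrams include the essential classes and $\dim H_k(K) = \dim H_k(K')$, then again $H$ is real-valued and Lipschitz continuous with constant $R_K + R_{K'}$. If $\dim H_k(K) \ne \dim H_k(K')$, then $H(\omega) = \infty$ for every $\omega$. -/

import Mathlib

open scoped NNReal ENNReal

noncomputable section

namespace PHT

/-! ### Simplicial homology with coefficients in a field -/

/-- The boundary operator on ordered simplicial chains: the `n`-chains are the finite formal
combinations of tuples `(v₀, …, vₙ)` of vertices, and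
`∂ (v₀, …, vₙ₊₁) = ∑ i, (-1) ^ i • (v₀, …, v̂ᵢ, …, vₙ₊₁)`. -/
def boundary (F : Type*) [Field F] (V : Type*) (n : ℕ) :
    ((Fin (n + 2) → V) →₀ F) →ₗ[F] ((Fin (n + 1) → V) →₀ F) :=
  Finsupp.linearCombination F fun τ : Fin (n + 2) → V =>
    ∑ i : Fin (n + 2), Finsupp.single (τ ∘ i.succAbove) ((-1 : F) ^ (i : ℕ))

/-- The ordered `n`-chains of the abstract simplicial complex with set of faces `S`: those
supported on tuples (repetitions allowed) whose vertices form a face. -/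
def chains (F : Type*) [Field F] {V : Type*} (S : Set (Finset V)) (n : ℕ) :
    Submodule F ((Fin (n + 1) → V) →₀ F) :=
  Finsupp.supported F F {τ : Fin (n + 1) → V | ∃ s ∈ S, (s : Set V) = Set.range τ}

/-- The `n`-cycles `Zₙ(S)`. -/
def cycles (F : Type*) [Field F] {V : Type*} (S : Set (Finset V)) :
    (n : ℕ) → Submodule F ((Fin (n + 1) → V) →₀ F)
  | 0 => chains F S 0
  | n + 1 => chains F S (n + 1) ⊓ LinearMap.ker (boundary F V n)

/-- The `n`-boundaries `Bₙ(S)`. -/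
def boundaries (F : Type*) [Field F] {V : Type*} (S : Set (Finset V)) (n : ℕ) :
    Submodule F ((Fin (n + 1) → V) →₀ F) :=
  (chains F S (n + 1)).map (boundary F V n)

/-- The dimension of the image of the subspace `Z` in the quotient by the subspace `B`, that is,
`dim Z / (Z ∩ B)`. -/
def imageRank {F : Type*} [Field F] {C : Type*} [AddCommGroup C] [Module F C]
    (Z B : Submodule F C) : ℕ :=
  Module.finrank F (Z.map B.mkQ)

/-- For complexes `S ⊆ T`, the persistent Betti number `dim Zₙ(S) / (Zₙ(S) ∩ Bₙ(T))`, that is, the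
rank of the map `Hₙ(S) → Hₙ(T)` induced by inclusion. -/
def persistentBetti (F : Type*) [Field F] {V : Type*} (S T : Set (Finset V)) (n : ℕ) : ℕ :=
  imageRank (cycles F S n) (boundaries F T n)

/-- The Betti number `dim Hₙ(S)`. -/
def betti (F : Type*) [Field F] {V : Type*} (S : Set (Finset V)) (n : ℕ) : ℕ :=
  persistentBetti F S S n

/-! ### The height filtration and its persistence diagrams -/

/-- The height function `h_ω(x) = ⟨x, ω⟩`. -/
def height {m : ℕ} (ω x : EuclideanSpace ℝ (Fin m)) : ℝ := inner ℝ x ω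

/-- The faces of `K` all of whose vertices have height in `I`. For `I = Set.Iic a` this is the
sublevel complex at height `a`, for `I = Set.Iio a` the complex just before height `a`. -/
def sublevel {m : ℕ} (K : Geometry.SimplicialComplex ℝ (EuclideanSpace ℝ (Fin m)))
    (ω : EuclideanSpace ℝ (Fin m)) (I : Set ℝ) : Set (Finset (EuclideanSpace ℝ (Fin m))) :=
  {s | s ∈ K.faces ∧ ∀ v ∈ s, height ω v ∈ I}

/-- The rank of the map in `k`-th homology from the complex of heights in `I` to the complex of
heights in `J`. -/
def rank {m : ℕ} (F : Type*) [Field F]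
    (K : Geometry.SimplicialComplex ℝ (EuclideanSpace ℝ (Fin m)))
    (ω : EuclideanSpace ℝ (Fin m)) (k : ℕ) (I J : Set ℝ) : ℕ :=
  persistentBetti F (sublevel K ω I) (sublevel K ω J) k

/-- The multiplicity of the point `(b, d)`, `b < d`, in the `k`-th persistence diagram: the number
of classes that are born at height `b` and die at height `d`, by inclusion-exclusion. -/
def multiplicity {m : ℕ} (F : Type*) [Field F]
    (K : Geometry.SimplicialComplex ℝ (EuclideanSpace ℝ (Fin m)))
    (ω : EuclideanSpace ℝ (Fin m)) (k : ℕ) (b d : ℝ) : ℕ :=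
  (((rank F K ω k (Set.Iic b) (Set.Iio d) : ℤ) - rank F K ω k (Set.Iio b) (Set.Iio d))
    - ((rank F K ω k (Set.Iic b) (Set.Iic d) : ℤ) - rank F K ω k (Set.Iio b) (Set.Iic d))).toNat

/-- The multiplicity of the point `(b, ∞)`: the number of classes that are born at height `b` and
never die. -/
def essentialMultiplicity {m : ℕ} (F : Type*) [Field F]
    (K : Geometry.SimplicialComplex ℝ (EuclideanSpace ℝ (Fin m)))
    (ω : EuclideanSpace ℝ (Fin m)) (k : ℕ) (b : ℝ) : ℕ :=
  ((rank F K ω k (Set.Iic b) Set.univ : ℤ) - rank F K ω k (Set.Iio b) Set.univ).toNat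

theorem finite_vertices {m : ℕ} {K : Geometry.SimplicialComplex ℝ (EuclideanSpace ℝ (Fin m))}
    (hK : K.faces.Finite) : K.vertices.Finite :=
  hK.preimage (Finset.singleton_injective.injOn)

/-- The heights of the vertices of a finite complex; these are the only heights at which the
filtration changes. -/
def vertexHeights {m : ℕ} (K : Geometry.SimplicialComplex ℝ (EuclideanSpace ℝ (Fin m)))
    (hK : K.faces.Finite) (ω : EuclideanSpace ℝ (Fin m)) : Finset ℝ :=
  ((finite_vertices hK).image (height ω)).toFinset

/-- The `k`-th persistence diagram `Dgm_k(h_ω^K)`, as a multiset of points `(birth, death)`, with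
the essential classes as points with death `⊤`. -/
def Dgm {m : ℕ} (F : Type*) [Field F]
    (K : Geometry.SimplicialComplex ℝ (EuclideanSpace ℝ (Fin m)))
    (hK : K.faces.Finite) (k : ℕ) (ω : EuclideanSpace ℝ (Fin m)) : Multiset (ℝ × WithTop ℝ) :=
  ∑ b ∈ vertexHeights K hK ω,
    ((∑ d ∈ vertexHeights K hK ω with b < d,
        Multiset.replicate (multiplicity F K ω k b d) (b, (d : WithTop ℝ)))
      + Multiset.replicate (essentialMultiplicity F K ω k b) (b, (⊤ : WithTop ℝ)))

open scoped Classical in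
/-- The points of finite persistence of a diagram. -/
def finitePart (X : Multiset (ℝ × WithTop ℝ)) : Multiset (ℝ × WithTop ℝ) :=
  X.filter fun p => p.2 ≠ ⊤

/-! ### Bottleneck distance -/

/-- The distance `|d - d'|` of two death values, with `|∞ - ∞| = 0` and `|∞ - d| = ∞`. -/
def deathDist : WithTop ℝ → WithTop ℝ → ℝ≥0∞
  | (d : ℝ), (d' : ℝ) => edist d d'
  | ⊤, ⊤ => 0
  | _, _ => ⊤

/-- The `L_∞`-distance of two points of persistence diagrams. -/
def pointDist (p q : ℝ × WithTop ℝ) : ℝ≥0∞ := max (edist p.1 q.1) (deathDist p.2 q.2)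

/-- The distance `|d - b| / 2` of the point `(b, d)` to the diagonal. -/
def diagDist (p : ℝ × WithTop ℝ) : ℝ≥0∞ := deathDist (p.1 : WithTop ℝ) p.2 / 2

/-- The bottleneck distance: the infimum over all partial matchings of the largest cost.
A partial matching of `X` and `Y` is a multiset `M` of matched pairs, together with the unmatched
points `U` of `X` and `W` of `Y`. -/
def bottleneck (X Y : Multiset (ℝ × WithTop ℝ)) : ℝ≥0∞ :=
  ⨅ (M : Multiset ((ℝ × WithTop ℝ) × (ℝ × WithTop ℝ)))
    (U : Multiset (ℝ × WithTop ℝ)) (W : Multiset (ℝ × WithTop ℝ))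
    (_ : M.map Prod.fst + U = X) (_ : M.map Prod.snd + W = Y),
    max (⨆ p ∈ M, pointDist p.1 p.2) (max (⨆ u ∈ U, diagDist u) (⨆ w ∈ W, diagDist w))

/-- The largest norm of a vertex of `K`, for `K` finite (and `0` for the empty complex). -/
def maxVertexNorm {m : ℕ} (K : Geometry.SimplicialComplex ℝ (EuclideanSpace ℝ (Fin m))) : ℝ≥0 :=
  sSup ((fun v => ‖v‖₊) '' K.vertices)

end PHT

end

/-!
The diagram of a height function is Lipschitz in the direction `ω`, with constant the largest
norm of a vertex (`PHT.bottleneck_Dgm_le`); the theorem follows from this and the triangle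
inequality for the bottleneck distance (`PHT.bottleneck_triangle`).

For the Lipschitz bound, let `ω` be so close to `ω'` that every strict inequality between vertex
heights in direction `ω'` persists in direction `ω`. Then the heights for `ω'` are a monotone
function `φ` of the heights for `ω`, and every sublevel complex for `ω'` is one for `ω`. Since
multiplicities are second differences of ranks, they telescope over the fibres of `φ`, so that the
diagram of `ω'` is the image of the diagram of `ω` under `φ` without the points that land on the
diagonal (`PHT.Dgm_eq_filter_map`). Here the truncation in `multiplicity` has to be harmless, which
is the submodularity of `dim Z / (Z ∩ B)` in `(Z, B)` (`PHT.imageRank_submodular`). As `φ` moves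
each height by at most `R * ‖ω - ω'‖`, this gives the bound for `ω` near `ω'`, and continuous
induction along a segment of (not necessarily unit) directions gives it for all pairs
(`PHT.bottleneck_le_of_eventually`).

In direction `0` all heights vanish, so the diagram there consists of `dim Hₖ` copies of `(0, ∞)`
(`PHT.Dgm_zero`). By the Lipschitz bound the distance of two diagrams is finite in direction `ω` if
and only if it is in direction `0`, that is, if and only if the Betti numbers agree; the finite
parts are empty in direction `0`, hence always at finite distance.
-/

namespace PHT

/-! ### Ranks of maps between subquotients -/

theorem imageRank_add_finrank_inf {F : Type*} [Field F] {C : Type*} [AddCommGroup C] [Module F C]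
    (Z B : Submodule F C) [FiniteDimensional F Z] :
    imageRank Z B + Module.finrank F ↥(Z ⊓ B) = Module.finrank F Z := by
  have h := LinearMap.finrank_range_add_finrank_ker (B.mkQ.domRestrict Z)
  rw [LinearMap.range_domRestrict, LinearMap.ker_domRestrict, Submodule.ker_mkQ] at h
  rw [← Submodule.map_comap_subtype, Submodule.finrank_map_subtype_eq]
  exact h

/-- Fewer classes of `Z₂` that are new relative to `Z₁` survive modulo a larger subspace; by
rank-nullity this is the dimension formula for `Z₂ ⊓ B₁` and `Z₁ ⊓ B₂` inside `Z₂ ⊓ B₂`. -/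
theorem imageRank_submodular {F : Type*} [Field F] {C : Type*} [AddCommGroup C] [Module F C]
    {Z₁ Z₂ B₁ B₂ : Submodule F C} [FiniteDimensional F Z₂] (hZ : Z₁ ≤ Z₂) (hB : B₁ ≤ B₂) :
    imageRank Z₂ B₂ + imageRank Z₁ B₁ ≤ imageRank Z₂ B₁ + imageRank Z₁ B₂ := by
  have : FiniteDimensional F Z₁ := Submodule.finiteDimensional_of_le hZ
  have : FiniteDimensional F ↥(Z₂ ⊓ B₁) := Submodule.finiteDimensional_of_le inf_le_left
  have : FiniteDimensional F ↥(Z₂ ⊓ B₂) := Submodule.finiteDimensional_of_le inf_le_left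
  have : FiniteDimensional F ↥(Z₁ ⊓ B₂) := Submodule.finiteDimensional_of_le inf_le_left
  have h := Submodule.finrank_sup_add_finrank_inf_eq (Z₂ ⊓ B₁) (Z₁ ⊓ B₂)
  have hinf : (Z₂ ⊓ B₁) ⊓ (Z₁ ⊓ B₂) = Z₁ ⊓ B₁ := by
    rw [inf_inf_inf_comm, inf_eq_right.2 hZ, inf_eq_left.2 hB]
  have hsup : (Z₂ ⊓ B₁) ⊔ (Z₁ ⊓ B₂) ≤ Z₂ ⊓ B₂ :=
    sup_le (inf_le_inf_left _ hB) (inf_le_inf_right _ hZ)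
  have hle := Submodule.finrank_mono hsup
  rw [hinf] at h
  have h11 := imageRank_add_finrank_inf Z₁ B₁
  have h12 := imageRank_add_finrank_inf Z₁ B₂
  have h21 := imageRank_add_finrank_inf Z₂ B₁
  have h22 := imageRank_add_finrank_inf Z₂ B₂
  omega

theorem imageRank_mono_left {F : Type*} [Field F] {C : Type*} [AddCommGroup C] [Module F C]
    {Z₁ Z₂ : Submodule F C} (B : Submodule F C) [FiniteDimensional F Z₂] (hZ : Z₁ ≤ Z₂) :
    imageRank Z₁ B ≤ imageRank Z₂ B :=
  Submodule.finrank_mono (Submodule.map_mono hZ)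

section Homology

variable (F : Type*) [Field F] {V : Type*}

theorem chains_mono {S T : Set (Finset V)} (h : S ⊆ T) (n : ℕ) : chains F S n ≤ chains F T n :=
  Finsupp.supported_mono fun _ ⟨s, hs, e⟩ => ⟨s, h hs, e⟩

theorem cycles_mono {S T : Set (Finset V)} (h : S ⊆ T) : ∀ n, cycles F S n ≤ cycles F T n
  | 0 => chains_mono F h 0
  | n + 1 => inf_le_inf_right _ (chains_mono F h (n + 1))

theorem boundaries_mono {S T : Set (Finset V)} (h : S ⊆ T) (n : ℕ) :
    boundaries F S n ≤ boundaries F T n :=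
  Submodule.map_mono (chains_mono F h _)

theorem cycles_le_chains (S : Set (Finset V)) : ∀ n, cycles F S n ≤ chains F S n
  | 0 => le_rfl
  | _ + 1 => inf_le_left

theorem finiteDimensional_cycles {S : Set (Finset V)} (hS : S.Finite) (n : ℕ) :
    FiniteDimensional F (cycles F S n) := by
  have hfin : {τ : Fin (n + 1) → V | ∃ s ∈ S, (s : Set V) = Set.range τ}.Finite := by
    refine (Set.Finite.pi' fun _ : Fin (n + 1) => hS.biUnion fun s _ => s.finite_toSet).subset ?_
    rintro τ ⟨s, hs, e⟩ i
    exact Set.mem_biUnion hs (e ▸ Set.mem_range_self i)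
  have := hfin.to_subtype
  have : FiniteDimensional F (chains F S n) :=
    Module.Finite.equiv (Finsupp.supportedEquivFinsupp _).symm
  exact Submodule.finiteDimensional_of_le (cycles_le_chains F S n)

theorem persistentBetti_empty (T : Set (Finset V)) (n : ℕ) : persistentBetti F ∅ T n = 0 := by
  have h : cycles F (∅ : Set (Finset V)) n = ⊥ := by
    refine le_bot_iff.1 ((cycles_le_chains F ∅ n).trans ?_)
    simp [chains]
  rw [persistentBetti, imageRank, h, Submodule.map_bot, finrank_bot]

end Homology

section Height

variable {m : ℕ} (F : Type*) [Field F]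
  {K : Geometry.SimplicialComplex ℝ (EuclideanSpace ℝ (Fin m))}
  (ω : EuclideanSpace ℝ (Fin m)) (k : ℕ)

theorem sublevel_mono {I J : Set ℝ} (h : I ⊆ J) : sublevel K ω I ⊆ sublevel K ω J :=
  fun _ hs => ⟨hs.1, fun v hv => h (hs.2 v hv)⟩

theorem rank_submodular (hK : K.faces.Finite) {I₁ I₂ J₁ J₂ : Set ℝ} (hI : I₁ ⊆ I₂) (hJ : J₁ ⊆ J₂) :
    rank F K ω k I₂ J₂ + rank F K ω k I₁ J₁ ≤ rank F K ω k I₂ J₁ + rank F K ω k I₁ J₂ := by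
  have := finiteDimensional_cycles F (hK.subset fun _ hs => hs.1 : (sublevel K ω I₂).Finite) k
  exact imageRank_submodular (cycles_mono F (sublevel_mono ω hI) k)
    (boundaries_mono F (sublevel_mono ω hJ) k)

end Height
/-! ### The bottleneck distance -/

theorem deathDist_comm (a b : WithTop ℝ) : deathDist a b = deathDist b a := by
  induction a using WithTop.recTopCoe <;> induction b using WithTop.recTopCoe
  all_goals first | rfl | exact edist_comm _ _

theorem deathDist_self (a : WithTop ℝ) : deathDist a a = 0 := by
  induction a using WithTop.recTopCoe
  · rfl
  · exact edist_self _

theorem deathDist_triangle (a b c : WithTop ℝ) :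
    deathDist a c ≤ deathDist a b + deathDist b c := by
  induction a using WithTop.recTopCoe <;> induction b using WithTop.recTopCoe <;>
    induction c using WithTop.recTopCoe
  all_goals first | exact edist_triangle _ _ _ | simp [deathDist]

theorem pointDist_comm (p q : ℝ × WithTop ℝ) : pointDist p q = pointDist q p := by
  rw [pointDist, pointDist, edist_comm, deathDist_comm]

theorem pointDist_self (p : ℝ × WithTop ℝ) : pointDist p p = 0 := by
  simp [pointDist, deathDist_self]

theorem pointDist_triangle (p q r : ℝ × WithTop ℝ) :
    pointDist p r ≤ pointDist p q + pointDist q r :=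
  max_le ((edist_triangle _ q.1 _).trans (add_le_add (le_max_left _ _) (le_max_left _ _)))
    ((deathDist_triangle _ q.2 _).trans (add_le_add (le_max_right _ _) (le_max_right _ _)))

/-- The distance to the diagonal is `1`-Lipschitz for the `L_∞`-distance: both coordinates
contribute to the change of persistence, and the factor `1 / 2` absorbs this. -/
theorem diagDist_le_pointDist_add (p q : ℝ × WithTop ℝ) :
    diagDist p ≤ pointDist p q + diagDist q := by
  have h1 : deathDist (p.1 : WithTop ℝ) q.1 ≤ pointDist p q := le_max_left _ _
  have h2 : deathDist q.2 p.2 ≤ pointDist p q := deathDist_comm q.2 p.2 ▸ le_max_right _ _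
  have h : deathDist (p.1 : WithTop ℝ) p.2 ≤
      2 * pointDist p q + deathDist (q.1 : WithTop ℝ) q.2 :=
    calc deathDist (p.1 : WithTop ℝ) p.2
        ≤ deathDist (p.1 : WithTop ℝ) q.1 + (deathDist (q.1 : WithTop ℝ) q.2
          + deathDist q.2 p.2) :=
          (deathDist_triangle _ _ _).trans (by gcongr; exact deathDist_triangle _ _ _)
      _ ≤ pointDist p q + (deathDist (q.1 : WithTop ℝ) q.2 + pointDist p q) := by gcongr
      _ = 2 * pointDist p q + deathDist (q.1 : WithTop ℝ) q.2 := by ring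
  refine (ENNReal.div_le_div_right h 2).trans_eq ?_
  rw [ENNReal.add_div, mul_comm, ENNReal.mul_div_cancel_right two_ne_zero ENNReal.ofNat_ne_top,
    diagDist]

/-- There is a partial matching of `X` and `Y` of cost at most `c`, where the matched parts `X₁`,
`Y₁` are put in bijection by a multiset relation. -/
def IsMatched (c : ℝ≥0∞) (X Y : Multiset (ℝ × WithTop ℝ)) : Prop :=
  ∃ X₁ U Y₁ W : Multiset (ℝ × WithTop ℝ), X₁ + U = X ∧ Y₁ + W = Y ∧
    Multiset.Rel (fun p q => pointDist p q ≤ c) X₁ Y₁ ∧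
    (∀ u ∈ U, diagDist u ≤ c) ∧ ∀ w ∈ W, diagDist w ≤ c

theorem exists_map_fst_snd_of_rel {α β : Type*} {r : α → β → Prop} {s : Multiset α}
    {t : Multiset β} (h : Multiset.Rel r s t) :
    ∃ M : Multiset (α × β), M.map Prod.fst = s ∧ M.map Prod.snd = t ∧ ∀ p ∈ M, r p.1 p.2 := by
  induction h with
  | zero => exact ⟨0, by simp⟩
  | @cons a b _ _ hab _ ih =>
    obtain ⟨M, rfl, rfl, hM⟩ := ih
    refine ⟨(a, b) ::ₘ M, by simp, by simp, fun p hp => ?_⟩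
    rcases Multiset.mem_cons.1 hp with rfl | hp
    exacts [hab, hM p hp]

theorem rel_comp {α β γ : Type*} {r : α → β → Prop} {r' : β → γ → Prop} {r'' : α → γ → Prop}
    (hr : ∀ a b c, r a b → r' b c → r'' a c) {s : Multiset α} {t : Multiset β} {u : Multiset γ}
    (h : Multiset.Rel r s t) (h' : Multiset.Rel r' t u) : Multiset.Rel r'' s u := by
  induction h generalizing u with
  | zero => rw [Multiset.rel_zero_left.1 h']; exact .zero
  | cons hab _ ih =>
    obtain ⟨c, u', hc, hu, rfl⟩ := Multiset.rel_cons_left.1 h'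
    exact .cons (hr _ _ _ hab hc) (ih hu)

theorem IsMatched.bottleneck_le {c : ℝ≥0∞} {X Y : Multiset (ℝ × WithTop ℝ)}
    (h : IsMatched c X Y) : bottleneck X Y ≤ c := by
  obtain ⟨X₁, U, Y₁, W, hX, hY, hr, hU, hW⟩ := h
  obtain ⟨M, rfl, rfl, hM⟩ := exists_map_fst_snd_of_rel hr
  exact iInf_le_of_le M <| iInf_le_of_le U <| iInf_le_of_le W <| iInf_le_of_le hX <|
    iInf_le_of_le hY <| max_le (iSup₂_le hM) (max_le (iSup₂_le hU) (iSup₂_le hW))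

theorem isMatched_of_bottleneck_lt {c : ℝ≥0∞} {X Y : Multiset (ℝ × WithTop ℝ)}
    (h : bottleneck X Y < c) : IsMatched c X Y := by
  simp only [bottleneck, iInf_lt_iff] at h
  obtain ⟨M, U, W, hX, hY, h⟩ := h
  obtain ⟨hM, h⟩ := max_lt_iff.1 h
  obtain ⟨hU, hW⟩ := max_lt_iff.1 h
  refine ⟨_, U, _, W, hX, hY, ?_, fun u hu => (le_iSup₂ u hu).trans hU.le,
    fun w hw => (le_iSup₂ w hw).trans hW.le⟩
  rw [Multiset.rel_map]
  exact Multiset.rel_refl_of_refl_on fun p hp => (iSup₂_le_iff.1 hM.le p hp)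

theorem IsMatched.symm {c : ℝ≥0∞} {X Y : Multiset (ℝ × WithTop ℝ)} (h : IsMatched c X Y) :
    IsMatched c Y X := by
  obtain ⟨X₁, U, Y₁, W, hX, hY, hr, hU, hW⟩ := h
  refine ⟨Y₁, W, X₁, U, hY, hX, ?_, hW, hU⟩
  rw [← Multiset.rel_flip]
  exact hr.mono fun p _ q _ hpq => by rwa [flip, pointDist_comm]

/-- Two decompositions of a multiset have a common refinement. -/
theorem exists_refinement_of_add_eq_add {α : Type*} {a b c d : Multiset α} (h : a + b = c + d) :
    ∃ s t u v, a = s + t ∧ b = u + v ∧ c = s + u ∧ d = t + v := by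
  classical
  refine ⟨a ∩ c, a - c, c - a, b - (c - a), ?_, ?_, ?_, ?_⟩ <;> ext x <;>
    have := congrArg (Multiset.count x) h <;> simp at this ⊢ <;> omega

/-- A point of the middle diagram that is matched on one side only passes its cost to its partner,
by `diagDist_le_pointDist_add`. -/
theorem IsMatched.trans {c c' : ℝ≥0∞} {X Y Z : Multiset (ℝ × WithTop ℝ)} (h : IsMatched c X Y)
    (h' : IsMatched c' Y Z) : IsMatched (c + c') X Z := by
  obtain ⟨X₁, U, Y₁, W, rfl, rfl, hr, hU, hW⟩ := h
  obtain ⟨Y₂, U', Z₂, W', hY, rfl, hr', hU', hW'⟩ := h'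
  obtain ⟨A, B, C, D, rfl, rfl, rfl, rfl⟩ := exists_refinement_of_add_eq_add hY.symm
  obtain ⟨XA, XB, hXA, hXB, rfl⟩ := Multiset.rel_add_right.1 hr
  obtain ⟨ZA, ZC, hZA, hZC, rfl⟩ := Multiset.rel_add_left.1 hr'
  refine ⟨XA, XB + U, ZA, ZC + W', (add_assoc _ _ _).symm, (add_assoc _ _ _).symm, ?_, ?_, ?_⟩
  · exact rel_comp (fun p q r h1 h2 => (pointDist_triangle p q r).trans (add_le_add h1 h2)) hXA hZA
  · intro u hu
    rcases Multiset.mem_add.1 hu with hu | hu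
    · obtain ⟨y, hy, huy⟩ := Multiset.exists_mem_of_rel_of_mem hXB hu
      exact (diagDist_le_pointDist_add u y).trans
        (add_le_add huy (hU' y (Multiset.mem_add.2 (.inl hy))))
    · exact (hU u hu).trans le_self_add
  · intro w hw
    rcases Multiset.mem_add.1 hw with hw | hw
    · obtain ⟨y, hy, hwy⟩ := Multiset.exists_mem_of_rel_of_mem (Multiset.rel_flip.2 hZC) hw
      rw [add_comm]
      refine (diagDist_le_pointDist_add w y).trans (add_le_add ?_ ?_)
      · rwa [pointDist_comm]
      · exact hW y (Multiset.mem_add.2 (.inl hy))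
    · exact (hW' w hw).trans le_add_self

theorem bottleneck_comm (X Y : Multiset (ℝ × WithTop ℝ)) : bottleneck X Y = bottleneck Y X :=
  le_antisymm (le_of_forall_gt fun _ hc => by
      obtain ⟨c', h1, h2⟩ := exists_between hc
      exact (isMatched_of_bottleneck_lt h1).symm.bottleneck_le.trans_lt h2)
    (le_of_forall_gt fun _ hc => by
      obtain ⟨c', h1, h2⟩ := exists_between hc
      exact (isMatched_of_bottleneck_lt h1).symm.bottleneck_le.trans_lt h2)

theorem bottleneck_triangle (X Y Z : Multiset (ℝ × WithTop ℝ)) :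
    bottleneck X Z ≤ bottleneck X Y + bottleneck Y Z := by
  refine ENNReal.le_of_forall_pos_le_add fun ε hε hfin => ?_
  have hε' : ((ε / 2 : ℝ≥0) : ℝ≥0∞) ≠ 0 := by
    simpa using hε.ne'
  have h1 := ENNReal.lt_add_right (ENNReal.add_lt_top.1 hfin).1.ne hε'
  have h2 := ENNReal.lt_add_right (ENNReal.add_lt_top.1 hfin).2.ne hε'
  refine ((isMatched_of_bottleneck_lt h1).trans
    (isMatched_of_bottleneck_lt h2)).bottleneck_le.trans_eq ?_
  rw [add_add_add_comm, ← ENNReal.coe_add, add_halves]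

theorem bottleneck_self (X : Multiset (ℝ × WithTop ℝ)) : bottleneck X X = 0 :=
  le_antisymm (IsMatched.bottleneck_le ⟨X, 0, X, 0, add_zero X, add_zero X,
    Multiset.rel_refl_of_refl_on fun p _ => (pointDist_self p).le, by simp, by simp⟩) zero_le

/-- In a matching of finite cost, points at infinity are matched with points at infinity. -/
theorem deathDist_lt_top_iff {a b : WithTop ℝ} : deathDist a b < ⊤ ↔ (a = ⊤ ↔ b = ⊤) := by
  induction a using WithTop.recTopCoe <;> induction b using WithTop.recTopCoe
  all_goals simp [deathDist, edist_lt_top]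

theorem rel_filter {α β : Type*} {r : α → β → Prop} {p : α → Prop} {q : β → Prop}
    [DecidablePred p] [DecidablePred q] (hpq : ∀ a b, r a b → (p a ↔ q b)) {s : Multiset α}
    {t : Multiset β} (h : Multiset.Rel r s t) : Multiset.Rel r (s.filter p) (t.filter q) := by
  induction h with
  | zero => exact .zero
  | @cons a b _ _ hab _ ih =>
    by_cases hp : p a
    · rw [Multiset.filter_cons_of_pos _ hp, Multiset.filter_cons_of_pos _ ((hpq a b hab).1 hp)]
      exact .cons hab ih
    · rwa [Multiset.filter_cons_of_neg _ hp,
        Multiset.filter_cons_of_neg _ (mt (hpq a b hab).2 hp)]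

theorem pointDist_ne_top_snd {p q : ℝ × WithTop ℝ} (h : pointDist p q < ⊤) :
    p.2 = ⊤ ↔ q.2 = ⊤ :=
  deathDist_lt_top_iff.1 ((le_max_right _ _).trans_lt h)

theorem bottleneck_finitePart_le (X Y : Multiset (ℝ × WithTop ℝ)) :
    bottleneck (finitePart X) (finitePart Y) ≤ bottleneck X Y := by
  classical
  refine le_of_forall_gt fun c hc => ?_
  obtain ⟨c', h1, h2⟩ := exists_between hc
  obtain ⟨X₁, U, Y₁, W, rfl, rfl, hr, hU, hW⟩ := isMatched_of_bottleneck_lt h1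
  refine lt_of_le_of_lt (IsMatched.bottleneck_le ?_) h2
  simp only [finitePart, Multiset.filter_add]
  exact ⟨_, _, _, _, rfl, rfl, rel_filter (fun p q hpq => not_congr <|
      pointDist_ne_top_snd (hpq.trans_lt (h2.trans_le le_top))) hr,
    fun u hu => hU u (Multiset.mem_of_mem_filter hu),
    fun w hw => hW w (Multiset.mem_of_mem_filter hw)⟩

theorem eq_of_bottleneck_replicate_lt_top {n n' : ℕ} {b b' : ℝ}
    (h : bottleneck (.replicate n (b, ⊤)) (.replicate n' (b', ⊤)) < ⊤) : n = n' := by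
  obtain ⟨c, h1, h2⟩ := exists_between h
  obtain ⟨X₁, U, Y₁, W, hX, hY, hr, hU, hW⟩ := isMatched_of_bottleneck_lt h1
  have hdiag : ∀ b : ℝ, ¬ diagDist (b, ⊤) ≤ c := fun b hb =>
    h2.not_ge (by simpa [diagDist, deathDist, ENNReal.top_div] using hb)
  have hU0 : U = 0 := Multiset.eq_zero_of_forall_notMem fun u hu => hdiag b <|
    Multiset.eq_of_mem_replicate (hX ▸ Multiset.mem_add.2 (.inr hu)) ▸ hU u hu
  have hW0 : W = 0 := Multiset.eq_zero_of_forall_notMem fun w hw => hdiag b' <|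
    Multiset.eq_of_mem_replicate (hY ▸ Multiset.mem_add.2 (.inr hw)) ▸ hW w hw
  have := Multiset.card_eq_card_of_rel hr
  simp_all

/-- Moving the points of a diagram by at most `c` and then dropping points that started within
`c` of the diagonal changes the diagram by at most `c`. -/
theorem bottleneck_filter_map_le {c : ℝ≥0∞} (X : Multiset (ℝ × WithTop ℝ))
    (Φ : ℝ × WithTop ℝ → ℝ × WithTop ℝ) (P : ℝ × WithTop ℝ → Prop) [DecidablePred P]
    (hΦ : ∀ x ∈ X, pointDist x (Φ x) ≤ c) (hP : ∀ x ∈ X, ¬ P (Φ x) → diagDist x ≤ c) :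
    bottleneck X ((X.map Φ).filter P) ≤ c := by
  refine IsMatched.bottleneck_le ⟨X.filter (P ∘ Φ), X.filter fun x => ¬ P (Φ x), _, 0,
    Multiset.filter_add_not _ _, add_zero _, ?_, ?_, by simp⟩
  · rw [Multiset.filter_map, Multiset.rel_map_right]
    exact Multiset.rel_refl_of_refl_on fun x hx => hΦ x (Multiset.mem_of_mem_filter hx)
  · intro u hu
    obtain ⟨h1, h2⟩ := Multiset.mem_filter.1 hu
    exact hP u h1 h2

/-! ### Coarsening the order of the vertices -/

/-- Telescoping over a finite lower set of jump heights, for a set function that only sees which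
points of `G` a set contains. -/
theorem sum_jumps_eq_sub (G : Finset ℝ) (R : Set ℝ → ℤ)
    (hR : ∀ I J : Set ℝ, (∀ x ∈ G, x ∈ I ↔ x ∈ J) → R I = R J) (T : Finset ℝ) (hTG : T ⊆ G)
    (hT : ∀ x ∈ G, ∀ y ∈ T, x ≤ y → x ∈ T) :
    ∑ b ∈ T, (R (Set.Iic b) - R (Set.Iio b)) = R T - R ∅ := by
  induction T using Finset.induction_on_max with
  | empty => simp
  | insert a S hS ih =>
    have haS : a ∉ S := fun h => lt_irrefl a (hS a h)
    have hlow : ∀ x ∈ G, ∀ y ∈ S, x ≤ y → x ∈ S := fun x hx y hy hxy =>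
      (Finset.mem_insert.1 (hT x hx y (Finset.mem_insert_of_mem hy) hxy)).resolve_left
        (hxy.trans_lt (hS y hy)).ne
    have h1 : R (Set.Iic a) = R (insert a S : Finset ℝ) := hR _ _ fun x hx =>
      ⟨fun h => hT x hx a (Finset.mem_insert_self _ _) h, fun h =>
        (Finset.mem_insert.1 h).elim (fun e => e.le) fun h => (hS x h).le⟩
    have h2 : R (Set.Iio a) = R S := hR _ _ fun x hx =>
      ⟨fun h => (Finset.mem_insert.1 (hT x hx a (Finset.mem_insert_self _ _)
        (le_of_lt h))).resolve_left (ne_of_lt h), fun h => hS x h⟩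
    rw [Finset.sum_insert haS, ih ((Finset.subset_insert _ _).trans hTG) hlow, h1, h2]
    ring

/-- If `φ` is monotone on the jump heights, the jump at `b` after applying `φ` is the sum of the
jumps at the heights that `φ` sends to `b`. -/
theorem sum_jumps_fiber (G : Finset ℝ) (R : Set ℝ → ℤ)
    (hR : ∀ I J : Set ℝ, (∀ x ∈ G, x ∈ I ↔ x ∈ J) → R I = R J) {φ : ℝ → ℝ}
    (hφ : MonotoneOn φ G) (b : ℝ) :
    ∑ x ∈ G with φ x = b, (R (Set.Iic x) - R (Set.Iio x)) =
      R (φ ⁻¹' Set.Iic b) - R (φ ⁻¹' Set.Iio b) := by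
  have h1 := sum_jumps_eq_sub G R hR (G.filter (φ · ≤ b)) (Finset.filter_subset _ _)
    fun x hx y hy hxy => Finset.mem_filter.2 ⟨hx,
      (hφ hx (Finset.mem_filter.1 hy).1 hxy).trans (Finset.mem_filter.1 hy).2⟩
  have h2 := sum_jumps_eq_sub G R hR (G.filter (φ · < b)) (Finset.filter_subset _ _)
    fun x hx y hy hxy => Finset.mem_filter.2 ⟨hx,
      (hφ hx (Finset.mem_filter.1 hy).1 hxy).trans_lt (Finset.mem_filter.1 hy).2⟩
  rw [hR _ (φ ⁻¹' Set.Iic b) fun x hx => by simp [hx]] at h1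
  rw [hR _ (φ ⁻¹' Set.Iio b) fun x hx => by simp [hx]] at h2
  have h3 : G.filter (φ · ≤ b) = G.filter (φ · = b) ∪ G.filter (φ · < b) := by
    rw [← Finset.filter_or]
    exact Finset.filter_congr fun x _ => le_iff_eq_or_lt
  rw [h3, Finset.sum_union (Finset.disjoint_filter.2 fun x _ h h' => h'.ne h), h2] at h1
  linarith

section Coarsening

variable {m : ℕ} (F : Type*) [Field F]
  {K : Geometry.SimplicialComplex ℝ (EuclideanSpace ℝ (Fin m))} (hK : K.faces.Finite)
  (ω ω' : EuclideanSpace ℝ (Fin m)) (k : ℕ)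

theorem mem_vertexHeights {x : ℝ} :
    x ∈ vertexHeights K hK ω ↔ ∃ v ∈ K.vertices, height ω v = x := by
  simp [vertexHeights]

theorem mem_vertices_of_mem_face {s : Finset (EuclideanSpace ℝ (Fin m))} (hs : s ∈ K.faces)
    {v : EuclideanSpace ℝ (Fin m)} (hv : v ∈ s) : v ∈ K.vertices :=
  K.down_closed hs (Finset.singleton_subset_iff.2 hv) (Finset.singleton_nonempty v)

theorem sublevel_univ : sublevel K ω Set.univ = K.faces := by
  simp [sublevel]

theorem sublevel_congr {I J : Set ℝ} (h : ∀ x ∈ vertexHeights K hK ω, x ∈ I ↔ x ∈ J) :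
    sublevel K ω I = sublevel K ω J := by
  ext s
  refine and_congr_right fun hs => forall₂_congr fun v hv => h _ ?_
  exact (mem_vertexHeights hK ω).2 ⟨v, mem_vertices_of_mem_face hs hv, rfl⟩

theorem sublevel_preimage {φ : ℝ → ℝ} (hφ : ∀ v ∈ K.vertices, φ (height ω v) = height ω' v)
    (I : Set ℝ) : sublevel K ω (φ ⁻¹' I) = sublevel K ω' I := by
  ext s
  refine and_congr_right fun hs => forall₂_congr fun v hv => ?_
  rw [Set.mem_preimage, hφ v (mem_vertices_of_mem_face hs hv)]

theorem coe_multiplicity (hK : K.faces.Finite) (b d : ℝ) :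
    (multiplicity F K ω k b d : ℤ) =
      ((rank F K ω k (Set.Iic b) (Set.Iio d) : ℤ) - rank F K ω k (Set.Iio b) (Set.Iio d))
        - ((rank F K ω k (Set.Iic b) (Set.Iic d) : ℤ)
          - rank F K ω k (Set.Iio b) (Set.Iic d)) := by
  have := rank_submodular F ω k hK (Set.Iio_subset_Iic_self (a := b))
    (Set.Iio_subset_Iic_self (a := d))
  rw [multiplicity, Int.toNat_of_nonneg (by omega)]

theorem coe_essentialMultiplicity (hK : K.faces.Finite) (b : ℝ) :
    (essentialMultiplicity F K ω k b : ℤ) =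
      (rank F K ω k (Set.Iic b) Set.univ : ℤ) - rank F K ω k (Set.Iio b) Set.univ := by
  have := finiteDimensional_cycles F
    (hK.subset fun _ hs => hs.1 : (sublevel K ω (Set.Iic b)).Finite) k
  have : rank F K ω k (Set.Iio b) Set.univ ≤ rank F K ω k (Set.Iic b) Set.univ :=
    imageRank_mono_left _ (cycles_mono F (sublevel_mono ω Set.Iio_subset_Iic_self) k)
  rw [essentialMultiplicity, Int.toNat_of_nonneg (by omega)]

variable {ω ω'} {φ : ℝ → ℝ}

theorem multiplicity_eq_sum (hφ : ∀ v ∈ K.vertices, φ (height ω v) = height ω' v)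
    (hmono : MonotoneOn φ (vertexHeights K hK ω)) (b d : ℝ) :
    multiplicity F K ω' k b d = ∑ x ∈ vertexHeights K hK ω with φ x = b,
      ∑ y ∈ vertexHeights K hK ω with φ y = d, multiplicity F K ω k x y := by
  have hJ : ∀ I : Set ℝ, ∑ y ∈ vertexHeights K hK ω with φ y = d,
      ((rank F K ω k I (Set.Iic y) : ℤ) - rank F K ω k I (Set.Iio y)) =
      rank F K ω k I (φ ⁻¹' Set.Iic d) - rank F K ω k I (φ ⁻¹' Set.Iio d) := fun I =>
    sum_jumps_fiber _ (fun J => (rank F K ω k I J : ℤ))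
      (fun J J' h => by simp only [rank, sublevel_congr hK ω h]) hmono d
  have hI := sum_jumps_fiber _ (fun I => (rank F K ω k I (φ ⁻¹' Set.Iio d) : ℤ)
      - rank F K ω k I (φ ⁻¹' Set.Iic d))
      (fun J J' h => by simp only [rank, sublevel_congr hK ω h]) hmono b
  zify
  rw [coe_multiplicity F ω' k hK]
  have hinner : ∀ x, ∑ y ∈ vertexHeights K hK ω with φ y = d, (multiplicity F K ω k x y : ℤ) =
      ((rank F K ω k (Set.Iic x) (φ ⁻¹' Set.Iio d) : ℤ)
        - rank F K ω k (Set.Iic x) (φ ⁻¹' Set.Iic d))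
      - ((rank F K ω k (Set.Iio x) (φ ⁻¹' Set.Iio d) : ℤ)
        - rank F K ω k (Set.Iio x) (φ ⁻¹' Set.Iic d)) := fun x => by
    have h1 := hJ (Set.Iic x)
    have h2 := hJ (Set.Iio x)
    rw [← neg_sub (rank F K ω k (Set.Iic x) (φ ⁻¹' Set.Iic d) : ℤ), ← h1,
      ← neg_sub (rank F K ω k (Set.Iio x) (φ ⁻¹' Set.Iic d) : ℤ), ← h2,
      ← Finset.sum_neg_distrib, ← Finset.sum_neg_distrib, ← Finset.sum_sub_distrib]
    refine Finset.sum_congr rfl fun y _ => ?_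
    rw [coe_multiplicity F ω k hK]
    ring
  simp only [hinner, hI]
  simp only [rank, sublevel_preimage ω ω' hφ]
  ring

theorem essentialMultiplicity_eq_sum (hφ : ∀ v ∈ K.vertices, φ (height ω v) = height ω' v)
    (hmono : MonotoneOn φ (vertexHeights K hK ω)) (b : ℝ) :
    essentialMultiplicity F K ω' k b =
      ∑ x ∈ vertexHeights K hK ω with φ x = b, essentialMultiplicity F K ω k x := by
  have hI := sum_jumps_fiber _ (fun I => (rank F K ω k I Set.univ : ℤ))
      (fun J J' h => by simp only [rank, sublevel_congr hK ω h]) hmono b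
  zify
  simp only [coe_essentialMultiplicity F _ k hK, hI]
  simp only [rank, sublevel_preimage ω ω' hφ, sublevel_univ]

theorem vertexHeights_eq_image (hφ : ∀ v ∈ K.vertices, φ (height ω v) = height ω' v) :
    vertexHeights K hK ω' = (vertexHeights K hK ω).image φ := by
  ext x
  simp only [Finset.mem_image, mem_vertexHeights]
  constructor
  · rintro ⟨v, hv, rfl⟩
    exact ⟨_, ⟨v, hv, rfl⟩, hφ v hv⟩
  · rintro ⟨_, ⟨v, hv, rfl⟩, rfl⟩
    exact ⟨v, hv, (hφ v hv).symm⟩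

theorem replicate_sum {ι α : Type*} (s : Finset ι) (n : ι → ℕ) (a : α) :
    Multiset.replicate (∑ i ∈ s, n i) a = ∑ i ∈ s, Multiset.replicate (n i) a :=
  map_sum (Multiset.replicateAddMonoidHom a) n s

theorem filter_sum {ι α : Type*} (s : Finset ι) (f : ι → Multiset α) (p : α → Prop)
    [DecidablePred p] : (∑ i ∈ s, f i).filter p = ∑ i ∈ s, (f i).filter p := by
  classical
  induction s using Finset.induction_on with
  | empty => simp
  | insert a s ha ih => rw [Finset.sum_insert ha, Finset.sum_insert ha, Multiset.filter_add, ih]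

open scoped Classical in
/-- If the heights in direction `ω'` are a monotone function `φ` of the heights in direction `ω`,
then the diagram of `ω'` is the image of the diagram of `ω` under `φ`, without the points that
`φ` sends to the diagonal. -/
theorem Dgm_eq_filter_map (hφ : ∀ v ∈ K.vertices, φ (height ω v) = height ω' v)
    (hmono : MonotoneOn φ (vertexHeights K hK ω)) :
    Dgm F K hK k ω' = ((Dgm F K hK k ω).map fun p => (φ p.1, p.2.map φ)).filter
      fun p => (p.1 : WithTop ℝ) < p.2 := by
  set G := vertexHeights K hK ω with hG
  have hR : ((Dgm F K hK k ω).map fun p => (φ p.1, p.2.map φ)).filter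
      (fun p => (p.1 : WithTop ℝ) < p.2) =
      ∑ x ∈ G, ((∑ y ∈ G with φ x < φ y,
        Multiset.replicate (multiplicity F K ω k x y) (φ x, (φ y : WithTop ℝ)))
        + Multiset.replicate (essentialMultiplicity F K ω k x) (φ x, (⊤ : WithTop ℝ))) := by
    rw [Dgm, ← Multiset.coe_mapAddMonoidHom, map_sum, filter_sum]
    refine Finset.sum_congr rfl fun x hx => ?_
    rw [map_add, map_sum, Multiset.filter_add, filter_sum]
    simp only [Multiset.coe_mapAddMonoidHom, Multiset.map_replicate, WithTop.map_coe,
      WithTop.map_top]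
    congr 1
    · rw [Finset.sum_filter, Finset.sum_filter]
      refine Finset.sum_congr rfl fun y hy => ?_
      by_cases h : φ x < φ y
      · have hxy : x < y := not_le.1 fun h' => (hmono hy hx h').not_gt h
        rw [if_pos h, if_pos hxy, Multiset.filter_eq_self]
        intro a ha
        rw [Multiset.eq_of_mem_replicate ha]
        exact WithTop.coe_lt_coe.2 h
      · rw [if_neg h]
        split_ifs
        · rw [Multiset.filter_eq_nil]
          intro a ha
          rw [Multiset.eq_of_mem_replicate ha]
          exact fun h' => h (WithTop.coe_lt_coe.1 h')
        · rfl
    · rw [Multiset.filter_eq_self]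
      intro a ha
      rw [Multiset.eq_of_mem_replicate ha]
      exact WithTop.coe_lt_top _
  rw [hR, Dgm, vertexHeights_eq_image hK hφ, ← hG]
  rw [← Finset.sum_fiberwise_of_maps_to (s := G) (t := G.image φ) (g := φ)
    fun x hx => Finset.mem_image_of_mem φ hx]
  refine Finset.sum_congr rfl fun b _ => ?_
  rw [Finset.sum_add_distrib, essentialMultiplicity_eq_sum F hK k hφ hmono, replicate_sum]
  congr 1
  · have hfib : ∀ x ∈ G.filter (φ · = b), ∑ y ∈ G with φ x < φ y,
        Multiset.replicate (multiplicity F K ω k x y) (φ x, (φ y : WithTop ℝ)) =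
        ∑ d ∈ G.image φ with b < d, ∑ y ∈ G with φ y = d,
          Multiset.replicate (multiplicity F K ω k x y) (b, (d : WithTop ℝ)) := by
      intro x hx
      obtain ⟨-, rfl⟩ := Finset.mem_filter.1 hx
      rw [← Finset.sum_fiberwise_of_maps_to (s := G.filter (φ x < φ ·))
        (t := (G.image φ).filter (φ x < ·)) (g := φ) fun y hy => Finset.mem_filter.2
          ⟨Finset.mem_image_of_mem φ (Finset.mem_filter.1 hy).1, (Finset.mem_filter.1 hy).2⟩]
      refine Finset.sum_congr rfl fun d hd => ?_
      rw [Finset.filter_filter]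
      refine Finset.sum_congr (Finset.filter_congr fun y _ => ?_) fun y hy => ?_
      · exact and_iff_right_of_imp fun h => h ▸ (Finset.mem_filter.1 hd).2
      · rw [(Finset.mem_filter.1 hy).2]
    rw [Finset.sum_congr rfl hfib, Finset.sum_comm]
    refine Finset.sum_congr rfl fun d _ => ?_
    rw [multiplicity_eq_sum F hK k hφ hmono, replicate_sum]
    exact Finset.sum_congr rfl fun x _ => replicate_sum _ _ _
  · refine Finset.sum_congr rfl fun x hx => ?_
    rw [(Finset.mem_filter.1 hx).2]

theorem mem_Dgm {p : ℝ × WithTop ℝ} (hp : p ∈ Dgm F K hK k ω) :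
    p.1 ∈ vertexHeights K hK ω ∧
      (p.2 = ⊤ ∨ ∃ d ∈ vertexHeights K hK ω, p.1 < d ∧ p.2 = d) := by
  obtain ⟨b, hb, hp⟩ := Multiset.mem_sum.1 hp
  rcases Multiset.mem_add.1 hp with hp | hp
  · obtain ⟨d, hd, hp⟩ := Multiset.mem_sum.1 hp
    obtain ⟨hd, hbd⟩ := Finset.mem_filter.1 hd
    rw [Multiset.eq_of_mem_replicate hp]
    exact ⟨hb, .inr ⟨d, hd, hbd, rfl⟩⟩
  · rw [Multiset.eq_of_mem_replicate hp]
    exact ⟨hb, .inl rfl⟩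

theorem bottleneck_Dgm_le_of_monotoneOn
    (hφ : ∀ v ∈ K.vertices, φ (height ω v) = height ω' v)
    (hmono : MonotoneOn φ (vertexHeights K hK ω)) {c : ℝ≥0∞}
    (hc : ∀ x ∈ vertexHeights K hK ω, edist x (φ x) ≤ c) :
    bottleneck (Dgm F K hK k ω) (Dgm F K hK k ω') ≤ c := by
  classical
  rw [Dgm_eq_filter_map F hK k hφ hmono]
  refine bottleneck_filter_map_le _ _ _ ?_ ?_
  · rintro ⟨b, d⟩ hp
    obtain ⟨hb, rfl | ⟨d, hd, -, rfl⟩⟩ := mem_Dgm F hK k hp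
    · exact max_le (hc _ hb) (zero_le)
    · exact max_le (hc _ hb) (hc _ hd)
  · rintro ⟨b, d⟩ hp hP
    obtain ⟨hb, rfl | ⟨d, hd, hbd, rfl⟩⟩ := mem_Dgm F hK k hp
    · exact absurd (WithTop.coe_lt_top _) hP
    · dsimp only at hb hbd hP
      have he : φ b = φ d := (hmono hb hd hbd.le).eq_of_not_lt
        fun h => hP (WithTop.coe_lt_coe.2 h)
      refine ENNReal.div_le_of_le_mul ?_
      calc edist b d ≤ edist b (φ b) + edist (φ b) d := edist_triangle _ _ _
        _ ≤ c + c := add_le_add (hc b hb) (by rw [he, edist_comm]; exact hc d hd)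
        _ = c * 2 := (mul_two c).symm

end Coarsening
/-! ### Lipschitz dependence of the diagram on the direction -/

section Stability

open Filter Topology

variable {m : ℕ} (F : Type*) [Field F]
  {K : Geometry.SimplicialComplex ℝ (EuclideanSpace ℝ (Fin m))} (hK : K.faces.Finite) (k : ℕ)

theorem edist_height_le (hK : K.faces.Finite) {v : EuclideanSpace ℝ (Fin m)}
    (hv : v ∈ K.vertices) (ω ω' : EuclideanSpace ℝ (Fin m)) :
    edist (height ω v) (height ω' v) ≤ maxVertexNorm K * edist ω ω' := by
  have hR : ‖v‖₊ ≤ maxVertexNorm K :=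
    le_csSup ((finite_vertices hK).image _).bddAbove ⟨v, hv, rfl⟩
  rw [edist_nndist, edist_nndist, ← ENNReal.coe_mul, ENNReal.coe_le_coe, nndist_eq_nnnorm,
    nndist_eq_nnnorm, height, height, ← inner_sub_right]
  exact (nnnorm_inner_le_nnnorm v (ω - ω')).trans (by gcongr)

theorem continuous_height (v : EuclideanSpace ℝ (Fin m)) :
    Continuous fun ω : EuclideanSpace ℝ (Fin m) => height ω v :=
  continuous_const.inner continuous_id

/-- If strict inequalities between vertex heights in direction `ω'` also hold in direction `ω`,
then the heights for `ω'` are a monotone function of those for `ω`. -/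
theorem bottleneck_Dgm_le_of_forall_lt {ω ω' : EuclideanSpace ℝ (Fin m)}
    (h : ∀ v ∈ K.vertices, ∀ w ∈ K.vertices, height ω' v < height ω' w →
      height ω v < height ω w) :
    bottleneck (Dgm F K hK k ω) (Dgm F K hK k ω') ≤ maxVertexNorm K * edist ω ω' := by
  have hle : ∀ v ∈ K.vertices, ∀ w ∈ K.vertices, height ω v ≤ height ω w →
      height ω' v ≤ height ω' w := fun v hv w hw hvw =>
    not_lt.1 fun h' => (h w hw v hv h').not_ge hvw
  let φ : ℝ → ℝ := Function.extend (fun v : K.vertices => height ω v)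
    (fun v : K.vertices => height ω' v) 0
  have hφ : ∀ v ∈ K.vertices, φ (height ω v) = height ω' v := fun v hv =>
    Function.FactorsThrough.extend_apply (f := fun v : K.vertices => height ω v)
      (g := fun v : K.vertices => height ω' v)
      (fun a b hab => le_antisymm (hle a a.2 b b.2 (le_of_eq hab))
        (hle b b.2 a a.2 (ge_of_eq hab))) 0 ⟨v, hv⟩
  refine bottleneck_Dgm_le_of_monotoneOn F hK k hφ ?_ ?_
  · intro x hx y hy hxy
    obtain ⟨v, hv, rfl⟩ := (mem_vertexHeights hK ω).1 hx
    obtain ⟨w, hw, rfl⟩ := (mem_vertexHeights hK ω).1 hy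
    rw [hφ v hv, hφ w hw]
    exact hle v hv w hw hxy
  · intro x hx
    obtain ⟨v, hv, rfl⟩ := (mem_vertexHeights hK ω).1 hx
    rw [hφ v hv]
    exact edist_height_le hK hv ω ω'

theorem eventually_bottleneck_Dgm_le (ω' : EuclideanSpace ℝ (Fin m)) :
    ∀ᶠ ω in 𝓝 ω', bottleneck (Dgm F K hK k ω) (Dgm F K hK k ω') ≤
      maxVertexNorm K * edist ω ω' := by
  have h : ∀ᶠ ω in 𝓝 ω', ∀ v ∈ K.vertices, ∀ w ∈ K.vertices, height ω' v < height ω' w →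
      height ω v < height ω w := by
    rw [(finite_vertices hK).eventually_all]
    intro v _
    rw [(finite_vertices hK).eventually_all]
    intro w _
    by_cases hvw : height ω' v < height ω' w
    · exact ((continuous_height v).continuousAt.eventually_lt
        (continuous_height w).continuousAt hvw).mono fun _ h _ => h
    · exact .of_forall fun _ h => absurd h hvw
  exact h.mono fun ω hω => bottleneck_Dgm_le_of_forall_lt F hK k hω

/-- A path of diagrams that is pointwise locally `C`-Lipschitz moves by at most `C` in unit time,
by continuous induction on the set of times `t` with `bottleneck (D 0) (D t) ≤ C * t`. -/
theorem bottleneck_le_of_eventually {D : ℝ → Multiset (ℝ × WithTop ℝ)} {C : ℝ≥0}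
    (h : ∀ t, ∀ᶠ s in 𝓝 t, bottleneck (D s) (D t) ≤ C * edist s t) :
    bottleneck (D 0) (D 1) ≤ C := by
  let S : Set ℝ := {t | bottleneck (D 0) (D t) ≤ C * ENNReal.ofReal t}
  have hclosed : IsClosed (S ∩ Set.Icc 0 1) := by
    refine isClosed_of_closure_subset fun t ht => ⟨?_, ?_⟩
    · have hf := (mem_closure_iff_frequently.1 ht).and_eventually (h t)
      have hcont : Continuous fun s : ℝ => C * ENNReal.ofReal s + C * edist s t :=
        ((ENNReal.continuous_const_mul ENNReal.coe_ne_top).comp ENNReal.continuous_ofReal).add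
          ((ENNReal.continuous_const_mul ENNReal.coe_ne_top).comp
            (continuous_id.edist continuous_const))
      have hlim := hcont.tendsto t
      simp only [edist_self, mul_zero, add_zero] at hlim
      exact ge_of_tendsto_of_frequently hlim <| hf.mono fun s hs =>
        (bottleneck_triangle _ (D s) _).trans (add_le_add hs.1.1 hs.2)
    · exact isClosed_Icc.closure_subset_iff.2 Set.inter_subset_right ht
  have hS0 : (0 : ℝ) ∈ S := by simp [S, bottleneck_self]
  have hsub := hclosed.Icc_subset_of_forall_exists_gt hS0 fun x hx y hy => by
    have hev : ∀ᶠ s in 𝓝[>] x, s ∈ Set.Ioc x y :=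
      Ioc_mem_nhdsGT hy
    obtain ⟨s, hs, hsx⟩ := (hev.and (nhdsWithin_le_nhds (h x))).exists
    refine ⟨s, ?_, hs⟩
    calc bottleneck (D 0) (D s) ≤ bottleneck (D 0) (D x) + bottleneck (D x) (D s) :=
          bottleneck_triangle _ _ _
      _ ≤ C * ENNReal.ofReal x + C * edist s x :=
          add_le_add hx.1 (by rw [bottleneck_comm]; exact hsx)
      _ = C * ENNReal.ofReal s := by
          rw [← mul_add, edist_dist, Real.dist_eq, abs_of_pos (sub_pos.2 hs.1),
            ← ENNReal.ofReal_add hx.2.1 (sub_pos.2 hs.1).le, add_sub_cancel]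
  have h1 : bottleneck (D 0) (D 1) ≤ C * ENNReal.ofReal 1 := hsub (Set.right_mem_Icc.2 zero_le_one)
  simpa using h1

theorem bottleneck_Dgm_le (ω ω' : EuclideanSpace ℝ (Fin m)) :
    bottleneck (Dgm F K hK k ω) (Dgm F K hK k ω') ≤ maxVertexNorm K * edist ω ω' := by
  have h := bottleneck_le_of_eventually (C := maxVertexNorm K * nndist ω ω')
    (D := fun t : ℝ => Dgm F K hK k (AffineMap.lineMap ω ω' t)) fun t => by
      have hc : ContinuousAt (fun s : ℝ => AffineMap.lineMap ω ω' s) t :=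
        AffineMap.lineMap_continuous.continuousAt
      refine (hc.eventually (eventually_bottleneck_Dgm_le F hK k _)).mono fun s hs =>
        hs.trans_eq ?_
      rw [edist_nndist, nndist_lineMap_lineMap, edist_nndist s t]
      push_cast
      ring
  simpa only [AffineMap.lineMap_apply_zero, AffineMap.lineMap_apply_one, ENNReal.coe_mul,
    ← edist_nndist] using h

/-- All vertices have height `0` in direction `0`, so no class dies at a positive distance from its
birth and the diagram records the homology of the whole complex. -/
theorem Dgm_zero : Dgm F K hK k 0 = Multiset.replicate (betti F K.faces k) (0, ⊤) := by
  have hG : ∀ x ∈ vertexHeights K hK 0, x = 0 := fun x hx => by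
    obtain ⟨v, -, rfl⟩ := (mem_vertexHeights hK 0).1 hx
    exact inner_zero_right v
  have hemp : sublevel K 0 (Set.Iio 0) = ∅ := by
    refine Set.eq_empty_of_forall_notMem fun s hs => ?_
    obtain ⟨v, hv⟩ := K.nonempty_of_mem_faces hs.1
    exact lt_irrefl (0 : ℝ) ((inner_zero_right v : height 0 v = 0) ▸ hs.2 v hv)
  rcases (vertexHeights K hK 0).eq_empty_or_nonempty with h0 | ⟨x, hx⟩
  · have hfaces : K.faces = ∅ := by
      refine Set.eq_empty_of_forall_notMem fun s hs => ?_
      obtain ⟨v, hv⟩ := K.nonempty_of_mem_faces hs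
      exact Finset.notMem_empty (height 0 v)
        (h0 ▸ (mem_vertexHeights hK 0).2 ⟨v, mem_vertices_of_mem_face hs hv, rfl⟩)
    rw [Dgm, h0, hfaces, betti, persistentBetti_empty]
    rfl
  · have h0 : vertexHeights K hK 0 = {0} :=
      Finset.eq_singleton_iff_unique_mem.2 ⟨hG x hx ▸ hx, hG⟩
    have hIic : sublevel K 0 (Set.Iic 0) = K.faces := by
      rw [← sublevel_univ (K := K) 0]
      exact sublevel_congr hK 0 fun x hx => by simp [hG x hx]
    have hess : essentialMultiplicity F K 0 k 0 = betti F K.faces k := by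
      simp [essentialMultiplicity, rank, hemp, hIic, sublevel_univ, persistentBetti_empty, betti]
    rw [Dgm, h0, Finset.sum_singleton, hess]
    simp

theorem finitePart_Dgm_zero : finitePart (Dgm F K hK k 0) = 0 := by
  rw [Dgm_zero, finitePart, Multiset.filter_eq_nil]
  intro p hp
  simp [Multiset.eq_of_mem_replicate hp]

end Stability

/-! ### Comparing two complexes -/

section Comparison

variable {m : ℕ} {A B : EuclideanSpace ℝ (Fin m) → Multiset (ℝ × WithTop ℝ)} {a b : ℝ≥0}

/-- The distance of two families of diagrams depends on the parameter in a Lipschitz way if both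
families do. -/
theorem bottleneck_le_add_of_forall_le
    (hA : ∀ ω ω', bottleneck (A ω) (A ω') ≤ a * edist ω ω')
    (hB : ∀ ω ω', bottleneck (B ω) (B ω') ≤ b * edist ω ω') (ω ω' : EuclideanSpace ℝ (Fin m)) :
    bottleneck (A ω) (B ω) ≤ bottleneck (A ω') (B ω') + (a + b : ℝ≥0) * edist ω ω' :=
  calc bottleneck (A ω) (B ω)
      ≤ bottleneck (A ω) (A ω') + (bottleneck (A ω') (B ω') + bottleneck (B ω') (B ω)) :=
        (bottleneck_triangle _ (A ω') _).trans (by gcongr; exact bottleneck_triangle _ _ _)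
    _ ≤ a * edist ω ω' + (bottleneck (A ω') (B ω') + b * edist ω ω') := by
        gcongr
        · exact hA ω ω'
        · exact edist_comm ω ω' ▸ hB ω' ω
    _ = _ := by push_cast; ring

theorem bottleneck_ne_top_of_ne_top
    (hA : ∀ ω ω', bottleneck (A ω) (A ω') ≤ a * edist ω ω')
    (hB : ∀ ω ω', bottleneck (B ω) (B ω') ≤ b * edist ω ω') {ω' : EuclideanSpace ℝ (Fin m)}
    (h : bottleneck (A ω') (B ω') ≠ ⊤) (ω : EuclideanSpace ℝ (Fin m)) :
    bottleneck (A ω) (B ω) ≠ ⊤ :=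
  ne_top_of_le_ne_top (ENNReal.add_ne_top.2 ⟨h, ENNReal.mul_ne_top ENNReal.coe_ne_top
    (edist_ne_top _ _)⟩) (bottleneck_le_add_of_forall_le hA hB ω ω')

/-- Finiteness of the distance at one parameter propagates to all, and then the distance is a
real-valued Lipschitz function. -/
theorem bottleneck_ne_top_and_lipschitzWith
    (hA : ∀ ω ω', bottleneck (A ω) (A ω') ≤ a * edist ω ω')
    (hB : ∀ ω ω', bottleneck (B ω) (B ω') ≤ b * edist ω ω') (h0 : bottleneck (A 0) (B 0) = 0) :
    (∀ ω : Metric.sphere (0 : EuclideanSpace ℝ (Fin m)) 1, bottleneck (A ω) (B ω) ≠ ⊤) ∧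
      LipschitzWith (a + b) fun ω : Metric.sphere (0 : EuclideanSpace ℝ (Fin m)) 1 =>
        (bottleneck (A ω) (B ω)).toReal := by
  have hfin := bottleneck_ne_top_of_ne_top hA hB (h0 ▸ ENNReal.zero_ne_top)
  refine ⟨fun ω => hfin ω, LipschitzWith.of_le_add_mul _ fun ω ω' => ?_⟩
  have hmul : ((a + b : ℝ≥0) : ℝ≥0∞) * edist (ω : EuclideanSpace ℝ (Fin m)) ω' ≠ ⊤ :=
    ENNReal.mul_ne_top ENNReal.coe_ne_top (edist_ne_top _ _)
  have h := ENNReal.toReal_mono (ENNReal.add_ne_top.2 ⟨hfin ω', hmul⟩)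
    (bottleneck_le_add_of_forall_le hA hB (ω : EuclideanSpace ℝ (Fin m)) ω')
  rwa [ENNReal.toReal_add (hfin ω') hmul, ENNReal.toReal_mul, ENNReal.coe_toReal,
    edist_dist, ENNReal.toReal_ofReal dist_nonneg] at h

end Comparison
end PHT

theorem mainTheorem7 (F : Type*) [Field F] (m : ℕ)
    (K K' : Geometry.SimplicialComplex ℝ (EuclideanSpace ℝ (Fin m)))
    (hK : K.faces.Finite) (hK' : K'.faces.Finite) (k : ℕ) :
    -- diagrams made of the points of finite persistence
    ((∀ ω : Metric.sphere (0 : EuclideanSpace ℝ (Fin m)) 1,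
        PHT.bottleneck (PHT.finitePart (PHT.Dgm F K hK k ω))
          (PHT.finitePart (PHT.Dgm F K' hK' k ω)) ≠ ⊤) ∧
      LipschitzWith (PHT.maxVertexNorm K + PHT.maxVertexNorm K')
        fun ω : Metric.sphere (0 : EuclideanSpace ℝ (Fin m)) 1 =>
          (PHT.bottleneck (PHT.finitePart (PHT.Dgm F K hK k ω))
            (PHT.finitePart (PHT.Dgm F K' hK' k ω))).toReal) ∧
    -- diagrams that include the essential classes
    (PHT.betti F K.faces k = PHT.betti F K'.faces k →
      (∀ ω : Metric.sphere (0 : EuclideanSpace ℝ (Fin m)) 1,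
        PHT.bottleneck (PHT.Dgm F K hK k ω) (PHT.Dgm F K' hK' k ω) ≠ ⊤) ∧
      LipschitzWith (PHT.maxVertexNorm K + PHT.maxVertexNorm K')
        fun ω : Metric.sphere (0 : EuclideanSpace ℝ (Fin m)) 1 =>
          (PHT.bottleneck (PHT.Dgm F K hK k ω) (PHT.Dgm F K' hK' k ω)).toReal) ∧
    (PHT.betti F K.faces k ≠ PHT.betti F K'.faces k →
      ∀ ω : Metric.sphere (0 : EuclideanSpace ℝ (Fin m)) 1,
        PHT.bottleneck (PHT.Dgm F K hK k ω) (PHT.Dgm F K' hK' k ω) = ⊤) := by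
  refine ⟨PHT.bottleneck_ne_top_and_lipschitzWith
      (A := fun ω => PHT.finitePart (PHT.Dgm F K hK k ω))
      (B := fun ω => PHT.finitePart (PHT.Dgm F K' hK' k ω))
      (fun ω ω' => (PHT.bottleneck_finitePart_le _ _).trans (PHT.bottleneck_Dgm_le F hK k ω ω'))
      (fun ω ω' => (PHT.bottleneck_finitePart_le _ _).trans (PHT.bottleneck_Dgm_le F hK' k ω ω'))
      ?_, fun h => PHT.bottleneck_ne_top_and_lipschitzWith
        (PHT.bottleneck_Dgm_le F hK k) (PHT.bottleneck_Dgm_le F hK' k) ?_, fun h ω => ?_⟩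
  · rw [PHT.finitePart_Dgm_zero, PHT.finitePart_Dgm_zero, PHT.bottleneck_self]
  · rw [PHT.Dgm_zero, PHT.Dgm_zero, h, PHT.bottleneck_self]
  · -- A finite distance in direction `ω` would make the distance in direction `0` finite.
    by_contra hω
    have h0 := PHT.bottleneck_ne_top_of_ne_top (PHT.bottleneck_Dgm_le F hK k)
      (PHT.bottleneck_Dgm_le F hK' k) hω 0
    rw [PHT.Dgm_zero, PHT.Dgm_zero] at h0
    exact h (PHT.eq_of_bottleneck_replicate_lt_top h0.lt_top)
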